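/- **Setting.** A $1$-current or $2$-current in $\mathbb{R}^2$ is a continuous linear functional on smooth compactly supported differential forms of that degree, $\partial T(\omega)=T(d\omega)$, and the mass $\mathbf V(T)$ is the supremum of $T(\omega)$ over forms of comass at most $1$. For $\lambda>0$ the multiscale flat norm of a $1$-current $T$ is $$\mathbb{F}_\lambda(T)=\inf_{S}\{\mathbf V(T-\partial S)+\lambda \mathbf V(S)\},$$ where $S$ runs over the integral $2$-currents in $\mathbb{R}^2$ (compactly supported, integer multiplicity, $\partial S$ of finite mass). Let $n\ge 3$ and let $T_0$ be a simple piecewise linear curve in $\mathbb{R}^2$ from $s$ to $t$ with nodes $v_0=s,v_1,\dots,v_n=t$ and edges $e_i=(v_{i-1},v_i)$: the edges are nondegenerate, consecutive edges meet exactly in their common node, and other pairs of edges are disjoint. A polygonal line is identified with the $1$-current that is the sum of its oriented edges. Write $|e_i|$ for edge lengths, $|T_0|=\sum_i|e_i|$, $e_s=e_1$, $e_t=e_n$, and $T_0[v_1,v_{n-1}]$ for the part of $T_0$ with edges $e_2,\dots,e_{n-1}$. Let $\delta>0$. A positive $\delta$-perturbation of an interior node $v$ of a polygonal line $T$, with preceding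 node $u$ and following node $w$, replaces $v$ by a point $\tilde v$ (and hence the edges $(u,v),(v,w)$ by $(u,\tilde v),(\tilde v,w)$) such that * $\|\tilde v-v\|<\delta$, * $\det[\tilde v-v,\,v-u]>0$ and $\det[\tilde v-v,\,w-v]>0$, where $\det[x,y]=x_1y_2-x_2y_1$, * the closed segment from $u$ to $\tilde v$ meets $T$ only in $u$, and the closed segment from $\tilde v$ to $w$ meets $T$ only in $w$. **Corollary (complete perturbation of the interior).** Let $\lambda>0$, and let $\tilde T_1^{0}=T_0,\ \tilde T_1^{1},\dots,\tilde T_1^{n-1}$ be such that, for $k=1,\dots,n-1$, $\tilde T_1^{k}$ arises from $\tilde T_1^{k-1}$ by a positive $\delta$-perturbation of the node $v_k$. Then $$\mathbb{F}_\lambda(\tilde T_1^{n-1}-T_0)\le\frac{\lambda\delta}{2}\Big(|T_0|+|T_0[v_1,v_{n-1}]|+(n-2)\delta\Big)=\lambda\delta\Big(|T_0|-\frac{|e_s|+|e_t|}{2}+(n-2)\frac{\delta}{2}\Big).$$ -/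

import Mathlib

open Set MeasureTheory
open scoped Distributions ENNReal

noncomputable section

/-- The Euclidean plane `ℝ²`. -/
abbrev Plane : Type := EuclideanSpace ℝ (Fin 2)

/-! ### Currents in the plane -/

/-- Smooth compactly supported differential `m`-forms on `ℝ²`, with the usual LF topology. -/
abbrev TestForm (m : ℕ) : Type :=
  𝓓((⊤ : TopologicalSpace.Opens Plane), Plane [⋀^Fin m]→L[ℝ] ℝ)

/-- `m`-currents in `ℝ²`: continuous linear functionals on the test `m`-forms. -/
abbrev Current (m : ℕ) : Type := TestForm m →L[ℝ] ℝ

/-- The exterior derivative of test forms. -/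
def extDerivTest (m : ℕ) : TestForm m →L[ℝ] TestForm (m + 1) :=
  (TestFunction.postcompCLM (ContinuousAlternatingMap.alternatizeUncurryFinCLM ℝ Plane ℝ)).comp
    (TestFunction.fderivCLM ℝ ⊤ ⊤)

theorem extDerivTest_apply {m : ℕ} (ω : TestForm m) (x : Plane) :
    extDerivTest m ω x = extDeriv ω x := by
  simp [extDerivTest, extDeriv]

/-- The boundary of a current, `∂T (ω) = T (dω)`. -/
def Current.boundary {m : ℕ} (T : Current (m + 1)) : Current m :=
  T.comp (extDerivTest m)

/-- The mass of a current: the supremum of `T ω` over the test forms `ω` of comass at most `1`.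
The comass of an alternating form on a Euclidean space equals its operator norm, by Hadamard's
inequality. For an area patch the mass is its area (counted with multiplicity), for a curve it
is its length. -/
def Current.mass {m : ℕ} (T : Current m) : ℝ≥0∞ :=
  ⨆ (ω : TestForm m) (_ : ∀ x, ‖ω x‖ ≤ 1), ENNReal.ofReal (T ω)

/-- Integral `2`-currents in `ℝ²`: compactly supported currents of integration over the plane
against an integrable integer multiplicity `θ` (the integer rectifiable currents of top
dimension; a negative multiplicity is a reversed orientation), with boundary of finite mass. -/
def Current.IsIntegral (S : Current 2) : Prop :=
  (∃ θ : Plane → ℤ, Integrable (fun x => (θ x : ℝ)) ∧ HasCompactSupport θ ∧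
    ∀ ω : TestForm 2, S ω =
      ∫ x, (θ x : ℝ) * ω x ![EuclideanSpace.single 0 1, EuclideanSpace.single 1 1]) ∧
  S.boundary.mass ≠ ⊤

/-- The multiscale flat norm of a `1`-current in `ℝ²` at scale `lam`. -/
def flatNorm (lam : ℝ) (T : Current 1) : ℝ≥0∞ :=
  ⨅ (S : Current 2) (_ : S.IsIntegral), (T - S.boundary).mass + ENNReal.ofReal lam * S.mass

theorem exists_segmentCurrent (a b : Plane) :
    ∃ A : Current 1, ∀ ω : TestForm 1,
      A ω = ∫ t in (0 : ℝ)..1, ω (AffineMap.lineMap a b t) ![b - a] := by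
  have hc : ∀ f : BoundedContinuousFunction Plane (Plane [⋀^Fin 1]→L[ℝ] ℝ),
      Continuous fun t : ℝ => f (AffineMap.lineMap a b t) ![b - a] := fun f =>
    (ContinuousAlternatingMap.apply ℝ Plane ℝ ![b - a]).continuous.comp
      (f.continuous.comp AffineMap.lineMap_continuous)
  let B : BoundedContinuousFunction Plane (Plane [⋀^Fin 1]→L[ℝ] ℝ) →ₗ[ℝ] ℝ :=
    { toFun := fun f => ∫ t in (0 : ℝ)..1, f (AffineMap.lineMap a b t) ![b - a]
      map_add' := fun f g => by
        rw [← intervalIntegral.integral_add ((hc f).intervalIntegrable _ _)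
          ((hc g).intervalIntegrable _ _)]
        simp
      map_smul' := fun c f => intervalIntegral.integral_const_mul c _ }
  have hB : ∀ f, ‖B f‖ ≤ ‖b - a‖ * ‖f‖ := fun f => by
    have h := intervalIntegral.norm_integral_le_of_norm_le_const (a := (0 : ℝ)) (b := 1)
      (C := ‖b - a‖ * ‖f‖) (f := fun t : ℝ => f (AffineMap.lineMap a b t) ![b - a])
      (fun t _ => by
        refine ((f (AffineMap.lineMap a b t)).le_opNorm _).trans ?_
        rw [mul_comm]
        simp only [Finset.univ_unique, Finset.prod_singleton, Matrix.cons_val_fin_one]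
        exact mul_le_mul_of_nonneg_left (f.norm_coe_le_norm _) (norm_nonneg _))
    rw [sub_zero, abs_one, mul_one] at h
    exact h
  exact ⟨(B.mkContinuous _ hB).comp (TestFunction.toBoundedContinuousFunctionCLM ℝ),
    fun ω => rfl⟩

/-- The current of integration along the oriented segment from `a` to `b`:
`ω ↦ ∫₀¹ ω (a + t (b - a)) (b - a) dt`. -/
def segmentCurrent (a b : Plane) : Current 1 where
  toFun ω := ∫ t in (0 : ℝ)..1, ω (AffineMap.lineMap a b t) ![b - a]
  map_add' ω η := by
    obtain ⟨A, hA⟩ := exists_segmentCurrent a b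
    simp only [← hA, map_add]
  map_smul' c ω := by
    obtain ⟨A, hA⟩ := exists_segmentCurrent a b
    simp only [← hA, map_smul, RingHom.id_apply]
  cont := by
    obtain ⟨A, hA⟩ := exists_segmentCurrent a b
    simpa only [← hA] using A.continuous

/-! ### Piecewise linear currents -/

/-- Polygonal lines with `n` edges, given by their nodes `v₀, …, vₙ`. -/
abbrev Polyline (n : ℕ) : Type := Fin (n + 1) → Plane

namespace Polyline

variable {n : ℕ}

/-- The `k`-th edge as a subset of the plane: the closed segment from node `k` to node `k + 1`
(edges are numbered from `0`). -/
def edge (T : Polyline n) (k : Fin n) : Set Plane := segment ℝ (T k.castSucc) (T k.succ)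

/-- The length of the `k`-th edge. -/
def edgeLength (T : Polyline n) (k : Fin n) : ℝ := dist (T k.castSucc) (T k.succ)

/-- The total length `|T|`. -/
def length (T : Polyline n) : ℝ := ∑ k, T.edgeLength k

/-- The underlying set of a polygonal line. -/
def support (T : Polyline n) : Set Plane := ⋃ k, T.edge k

/-- The `1`-current `e₁ + ⋯ + eₙ`. -/
def current (T : Polyline n) : Current 1 :=
  ∑ k : Fin n, segmentCurrent (T k.castSucc) (T k.succ)

/-- The part `T[vᵢ, vⱼ]` between the nodes `i ≤ j`. -/
def sub (T : Polyline n) (i j : ℕ) (hij : i ≤ j) (hj : j ≤ n) : Polyline (j - i) :=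
  fun k => T ⟨i + k, by omega⟩

end Polyline

/-- The class `𝓛ₙ[s, t]` of simple piecewise linear curves from `s` to `t` with `n` edges: edges
are nondegenerate, consecutive ones meet exactly in their common node, others are disjoint. -/
structure IsPWL (n : ℕ) (s t : Plane) (T : Polyline n) : Prop where
  start_eq : T 0 = s
  end_eq : T (Fin.last n) = t
  nondegenerate : ∀ k : Fin n, T k.castSucc ≠ T k.succ
  consecutive : ∀ i j : Fin n, (i : ℕ) + 1 = j → T.edge i ∩ T.edge j = {T j.castSucc}
  disjoint : ∀ i j : Fin n, (i : ℕ) + 1 < j → Disjoint (T.edge i) (T.edge j)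

/-! ### Positive perturbations of interior nodes -/

/-- `det [x, y]ᵀ = x₁ y₂ - x₂ y₁`. -/
def planeDet (x y : Plane) : ℝ := x 0 * y 1 - x 1 * y 0

/-- The positive cone in the open `δ`-ball at a node `v` with neighbours `u` and `w`. -/
def positiveCone (δ : ℝ) (u v w : Plane) : Set Plane :=
  {x | x ∈ Metric.ball v δ ∧ 0 < planeDet (x - v) (v - u) ∧ 0 < planeDet (x - v) (w - v)}

/-- The points `x` of the open `δ`-ball at `v` such that the new edges from `u` to `x` and from
`x` to `w` meet the curve `C` only in the nodes `u` and `w` that are kept. -/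
def allowedRegion (δ : ℝ) (u v w : Plane) (C : Set Plane) : Set Plane :=
  {x | x ∈ Metric.ball v δ ∧ segment ℝ u x ∩ C = {u} ∧ segment ℝ x w ∩ C = {w}}

/-- `T'` arises from `T` by a positive `δ`-perturbation of the interior node `k`. -/
def IsPositivePerturbation {n : ℕ} (δ : ℝ) (k : ℕ) (hk : 1 ≤ k ∧ k + 1 ≤ n)
    (T T' : Polyline n) : Prop :=
  let u := T ⟨k - 1, by omega⟩
  let v := T ⟨k, by omega⟩
  let w := T ⟨k + 1, by omega⟩
  ∃ x ∈ positiveCone δ u v w ∩ allowedRegion δ u v w T.support,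
    T' = Function.update T ⟨k, by omega⟩ x

end

/-! Moving a node `v` with neighbours `u`, `w` to `x` changes the curve by the boundary of the
triangles `u x v` and `x w v`, whose common side cancels. Each has an edge at `v` as base and height
at most `δ`, so the filling has mass at most `δ/2 * (|uv| + |vw|)` (`hasFilling_replace_node`). When
a node is moved, it and its successor are still original and its predecessor has moved by at most
`δ`, or not at all if it is `s`. Summing (`hasFilling_of_perturbations`) counts interior edges
twice, end edges once, and `δ` exactly `n - 2` times. The sum of the fillings is a competitor in the
flat norm.

The analytic core is `hasFilling_triangle`: Green's formula on a triangle, and a change of variables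
giving an integer multiplicity. -/

noncomputable section

/-! ### Green's formula and integration on a triangle -/

/-- The map `(r, t) ↦ a + r (w + t z)`, which collapses the unit square onto the triangle with
vertices `a`, `a + w` and `a + w + z`. -/
def coneMap (a w z : Plane) (p : ℝ × ℝ) : Plane := a + p.1 • (w + p.2 • z)

theorem hasFDerivAt_coneMap (a w z : Plane) (p : ℝ × ℝ) :
    HasFDerivAt (coneMap a w z)
      (p.1 • ((ContinuousLinearMap.snd ℝ ℝ ℝ).smulRight z) +
        (ContinuousLinearMap.fst ℝ ℝ ℝ).smulRight (w + p.2 • z)) p :=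
  ((hasFDerivAt_fst (𝕜 := ℝ) (p := p)).smul
    (((hasFDerivAt_snd (𝕜 := ℝ) (p := p)).smul_const z).const_add w)).const_add a

theorem continuous_coneMap (a w z : Plane) : Continuous (coneMap a w z) := by
  unfold coneMap; fun_prop

/-- Green's formula on a triangle, for the `1`-form with coefficients `A = ω(w)` and
`B = ω(z)`. -/
theorem integral_coneMap_green {A B : Plane → ℝ} (hA : ContDiff ℝ 1 A) (hB : ContDiff ℝ 1 B)
    (a w z : Plane) :
    (∫ r in (0 : ℝ)..1, ∫ t in (0 : ℝ)..1,
        r * (fderiv ℝ B (coneMap a w z (r, t)) w - fderiv ℝ A (coneMap a w z (r, t)) z)) =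
      (∫ t in (0 : ℝ)..1, B (coneMap a w z (1, t))) +
        (∫ r in (0 : ℝ)..1, A (coneMap a w z (r, 0))) -
        ∫ r in (0 : ℝ)..1, (A (coneMap a w z (r, 1)) + B (coneMap a w z (r, 1))) := by
  have hF := continuous_coneMap a w z
  have hd : ∀ {C : Plane → ℝ}, ContDiff ℝ 1 C → ∀ p,
      HasFDerivAt (fun p => C (coneMap a w z p)) ((fderiv ℝ C (coneMap a w z p)).comp
        (p.1 • ((ContinuousLinearMap.snd ℝ ℝ ℝ).smulRight z) +
          (ContinuousLinearMap.fst ℝ ℝ ℝ).smulRight (w + p.2 • z))) p := fun hC p =>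
    (hC.differentiable one_ne_zero _).hasFDerivAt.comp p (hasFDerivAt_coneMap a w z p)
  -- The pulled-back form is `(A + t B) dr + r B dt`; in its exterior derivative the terms `B` and
  -- `r t dB(z)` cancel.
  have key := integral2_divergence_prod_of_hasFDerivAt_off_countable
    (fun p => p.1 * B (coneMap a w z p))
    (fun p => -(A (coneMap a w z p) + p.2 * B (coneMap a w z p))) _ _ 0 0 1 1 ∅ countable_empty
    (by have := hB.continuous; fun_prop)
    (by have := hB.continuous; have := hA.continuous; fun_prop)
    (fun p _ => (hasFDerivAt_fst (𝕜 := ℝ) (p := p)).mul (hd hB p))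
    (fun p _ => ((hd hA p).add ((hasFDerivAt_snd (𝕜 := ℝ) (p := p)).mul (hd hB p))).neg)
    (by
      have := hB.continuous
      have h1 := (hB.continuous_fderiv one_ne_zero).comp hF
      have h2 := (hA.continuous_fderiv one_ne_zero).comp hF
      simp only [Function.comp_def] at h1 h2
      refine ContinuousOn.integrableOn_compact (isCompact_uIcc.prod isCompact_uIcc) ?_
      apply Continuous.continuousOn
      simp
      fun_prop)
  refine Eq.trans ?_ (key.trans ?_)
  · refine intervalIntegral.integral_congr fun r _ => intervalIntegral.integral_congr fun t _ => ?_
    simp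
    ring
  · simp only [one_mul, zero_mul, add_zero, intervalIntegral.integral_neg,
      intervalIntegral.integral_zero]
    ring

/-- Precomposing with the coordinates gives an endomorphism of the plane, as the change of variables
requires. -/
theorem det_coneMap_deriv (w z : Plane) (r t : ℝ) :
    (((r • ((ContinuousLinearMap.snd ℝ ℝ ℝ).smulRight z) +
        (ContinuousLinearMap.fst ℝ ℝ ℝ).smulRight (w + t • z)).comp
      ((EuclideanSpace.proj (0 : Fin 2) : Plane →L[ℝ] ℝ).prod
        (EuclideanSpace.proj (1 : Fin 2)))) : Plane →L[ℝ] Plane).det = r * planeDet w z := by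
  rw [ContinuousLinearMap.det, ← LinearMap.det_toMatrix (EuclideanSpace.basisFun (Fin 2) ℝ).toBasis,
    Matrix.det_fin_two]
  simp [LinearMap.toMatrix_apply, planeDet]
  ring

/-- Pairing with `z` under the determinant recovers `r`, pairing with `w` recovers `r t`; the open
square excludes the collapsed side `r = 0`. -/
theorem injOn_coneMap (a : Plane) {w z : Plane} (h : planeDet w z ≠ 0) :
    InjOn (coneMap a w z) (Ioo 0 1 ×ˢ Ioo 0 1) := by
  rintro ⟨r, t⟩ ⟨hr, -⟩ ⟨r', t'⟩ - heq
  have h0 := congrArg (fun x : Plane => x 0) heq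
  have h1 := congrArg (fun x : Plane => x 1) heq
  simp [coneMap] at h0 h1
  have hrr : r = r' := by
    apply mul_right_cancel₀ h
    unfold planeDet
    linear_combination z 1 * h0 - z 0 * h1
  subst hrr
  have : r * t = r * t' := by
    apply mul_right_cancel₀ h
    unfold planeDet
    linear_combination w 0 * h1 - w 1 * h0
  rw [mul_left_cancel₀ hr.1.ne' this]

theorem setIntegral_coneMap_image (a : Plane) {w z : Plane} (h : planeDet w z ≠ 0)
    {g : Plane → ℝ} (hg : Continuous g) :
    MeasurableSet (coneMap a w z '' (Ioo 0 1 ×ˢ Ioo 0 1)) ∧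
      ∫ x in coneMap a w z '' (Ioo 0 1 ×ˢ Ioo 0 1), g x =
        |planeDet w z| * ∫ r in (0 : ℝ)..1, ∫ t in (0 : ℝ)..1, r * g (coneMap a w z (r, t)) := by
  let e : Plane ≃ᵐ ℝ × ℝ := (MeasurableEquiv.toLp 2 (Fin 2 → ℝ)).symm.trans
    MeasurableEquiv.finTwoArrow
  have he : MeasurePreserving e :=
    (volume_preserving_finTwoArrow ℝ).comp
      (EuclideanSpace.volume_preserving_symm_measurableEquiv_toLp (Fin 2))
  set Q : Set (ℝ × ℝ) := Ioo 0 1 ×ˢ Ioo 0 1 with hQ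
  have hQm : MeasurableSet Q := measurableSet_Ioo.prod measurableSet_Ioo
  have hU : MeasurableSet (e ⁻¹' Q) := e.measurable hQm
  have himg : coneMap a w z '' Q = (coneMap a w z ∘ e) '' (e ⁻¹' Q) := by
    rw [image_comp, image_preimage_eq _ e.surjective]
  have hd : ∀ p ∈ e ⁻¹' Q, HasFDerivWithinAt (coneMap a w z ∘ e) _ (e ⁻¹' Q) p := fun p _ =>
    ((hasFDerivAt_coneMap a w z (e p)).comp p
      ((EuclideanSpace.proj (0 : Fin 2) : Plane →L[ℝ] ℝ).prod
        (EuclideanSpace.proj (1 : Fin 2))).hasFDerivAt).hasFDerivWithinAt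
  have hinj : InjOn (coneMap a w z ∘ e) (e ⁻¹' Q) :=
    (injOn_coneMap a h).comp e.injective.injOn (mapsTo_preimage _ _)
  rw [himg]
  refine ⟨measurable_image_of_fderivWithin hU hd hinj, ?_⟩
  rw [integral_image_eq_integral_abs_det_fderiv_smul volume hU hd hinj]
  simp only [det_coneMap_deriv, Function.comp_apply]
  rw [he.setIntegral_preimage_emb e.measurableEmbedding
    (fun q => |q.1 * planeDet w z| • g (coneMap a w z q)), hQ]
  have hc := continuous_coneMap a w z
  rw [Measure.volume_eq_prod, setIntegral_prod]
  · rw [← intervalIntegral.integral_const_mul, intervalIntegral.integral_of_le zero_le_one,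
      ← integral_Ioc_eq_integral_Ioo]
    refine setIntegral_congr_fun measurableSet_Ioc fun r hr => ?_
    simp only
    rw [← intervalIntegral.integral_const_mul, intervalIntegral.integral_of_le zero_le_one,
      ← integral_Ioc_eq_integral_Ioo]
    simp only [abs_mul, abs_of_pos hr.1, smul_eq_mul]
    congr! 2
    ring
  · refine IntegrableOn.mono_set (t := Icc 0 1 ×ˢ Icc 0 1) ?_
      (prod_mono Ioo_subset_Icc_self Ioo_subset_Icc_self)
    exact ContinuousOn.integrableOn_compact (isCompact_Icc.prod isCompact_Icc)
      (by fun_prop)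

/-- The integer multiplicity of an oriented triangle. -/
theorem exists_triangle_multiplicity (a w z : Plane) :
    ∃ θ : Plane → ℤ, Integrable (fun x => (θ x : ℝ)) ∧ HasCompactSupport θ ∧
      ∀ g : Plane → ℝ, Continuous g → ∫ x, (θ x : ℝ) * g x =
        planeDet w z * ∫ r in (0 : ℝ)..1, ∫ t in (0 : ℝ)..1, r * g (coneMap a w z (r, t)) := by
  by_cases h : planeDet w z = 0
  · exact ⟨0, by simp, HasCompactSupport.zero, by simp [h]⟩
  have hm := (setIntegral_coneMap_image a h (g := 0) continuous_const).1
  set s := coneMap a w z '' (Ioo 0 1 ×ˢ Ioo 0 1) with hs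
  have hK : IsCompact (coneMap a w z '' (Icc 0 1 ×ˢ Icc 0 1)) :=
    (isCompact_Icc.prod isCompact_Icc).image (continuous_coneMap a w z)
  have hsK : s ⊆ coneMap a w z '' (Icc 0 1 ×ˢ Icc 0 1) :=
    image_mono (prod_mono Ioo_subset_Icc_self Ioo_subset_Icc_self)
  have hfin : volume s ≠ ⊤ := ((measure_mono hsK).trans_lt hK.measure_lt_top).ne
  have hθ : ∀ x, ((s.indicator (fun _ => (SignType.sign (planeDet w z) : ℤ)) x : ℤ) : ℝ) =
      s.indicator (fun _ => (SignType.sign (planeDet w z) : ℝ)) x := fun x => by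
    by_cases hx : x ∈ s <;> simp [hx]
  -- The sign turns the Jacobian factor `|det|` into the oriented `det`.
  refine ⟨s.indicator fun _ => (SignType.sign (planeDet w z) : ℤ), ?_, ?_, fun g hg => ?_⟩
  · simp only [hθ]
    exact (integrable_indicator_iff hm).2 (integrableOn_const hfin)
  · exact HasCompactSupport.intro hK fun x hx => indicator_of_notMem (fun h => hx (hsK h)) _
  · simp only [hθ, ← indicator_mul_left]
    rw [integral_indicator hm, integral_const_mul, (setIntegral_coneMap_image a h hg).2,
      ← mul_assoc, sign_mul_abs]

/-! ### Covectors, masses and integral currents -/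

/-- The coefficient of a `2`-covector with respect to `dx ∧ dy`. -/
def areaCoeff : (Plane [⋀^Fin 2]→L[ℝ] ℝ) →L[ℝ] ℝ :=
  ContinuousAlternatingMap.apply ℝ Plane ℝ ![EuclideanSpace.single 0 1, EuclideanSpace.single 1 1]

theorem areaCoeff_apply (φ : Plane [⋀^Fin 2]→L[ℝ] ℝ) :
    areaCoeff φ = φ ![EuclideanSpace.single 0 1, EuclideanSpace.single 1 1] := rfl

theorem abs_areaCoeff_le (φ : Plane [⋀^Fin 2]→L[ℝ] ℝ) : |areaCoeff φ| ≤ ‖φ‖ := by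
  simpa [areaCoeff_apply] using
    φ.le_opNorm ![EuclideanSpace.single 0 1, EuclideanSpace.single 1 1]

theorem alternating_apply_eq_planeDet_mul (φ : Plane [⋀^Fin 2]→L[ℝ] ℝ) (w z : Plane) :
    φ ![w, z] = planeDet w z * areaCoeff φ := by
  have := φ.toAlternatingMap.eq_smul_basis_det (EuclideanSpace.basisFun (Fin 2) ℝ).toBasis
  have h2 := congrArg (fun ψ => ψ ![w, z]) this
  simp [Module.Basis.det_apply, Matrix.det_fin_two, Module.Basis.toMatrix_apply] at h2
  rw [areaCoeff_apply, h2, planeDet]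
  have hb : ⇑(EuclideanSpace.basisFun (Fin 2) ℝ) =
      ![EuclideanSpace.single 0 1, EuclideanSpace.single 1 1] := by
    ext i j
    fin_cases i <;> simp
  rw [hb]
  ring

theorem extDerivTest_apply_pair (ω : TestForm 1) (x w z : Plane) :
    extDerivTest 1 ω x ![w, z] =
      fderiv ℝ (fun y => ω y ![z]) x w - fderiv ℝ (fun y => ω y ![w]) x z := by
  rw [extDerivTest_apply, extDeriv_apply (ω.contDiff.differentiable (by simp) x)]
  have h1 : Fin.removeNth 1 ![w, z] = ![w] := by
    ext i
    fin_cases i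
    rfl
  simp [Fin.sum_univ_two, sub_eq_add_neg, h1]

/-- The `2`-current of integration over the plane with an integrable multiplicity. -/
theorem exists_multiplicityCurrent {θ : Plane → ℝ} (hθ : Integrable θ) :
    ∃ S : Current 2, ∀ ω : TestForm 2, S ω =
      ∫ x, θ x * ω x ![EuclideanSpace.single 0 1, EuclideanSpace.single 1 1] := by
  refine ⟨TestFunction.integralAgainstBilinCLM
    ((ContinuousLinearMap.mul ℝ ℝ).comp areaCoeff) volume θ, fun ω => ?_⟩
  rw [TestFunction.integralAgainstBilinCLM_eq_integral (hθ.locallyIntegrable.locallyIntegrableOn _)]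
  simp [areaCoeff_apply, mul_comm]

theorem covector_add (φ : Plane [⋀^Fin 1]→L[ℝ] ℝ) (u v : Plane) :
    φ ![u + v] = φ ![u] + φ ![v] := by
  have h := φ.map_update_add ![u] 0 u v
  have hu : ∀ x : Plane, Function.update ![u] 0 x = ![x] := fun x => by
    ext i
    fin_cases i
    simp
  simpa only [hu] using h

theorem segmentCurrent_apply (a b : Plane) (ω : TestForm 1) : segmentCurrent a b ω =
    ∫ t in (0 : ℝ)..1, ω (AffineMap.lineMap a b t) ![b - a] := rfl

theorem segmentCurrent_swap (a b : Plane) : segmentCurrent b a = -segmentCurrent a b := by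
  ext ω
  have h := intervalIntegral.integral_comp_sub_left (a := 0) (b := 1)
    (fun t : ℝ => ω (AffineMap.lineMap a b t) ![b - a]) 1
  have hneg : ∀ φ : Plane [⋀^Fin 1]→L[ℝ] ℝ, φ ![a - b] = -φ ![b - a] := fun φ => by
    rw [eq_neg_iff_add_eq_zero, ← covector_add, sub_add_sub_cancel, sub_self]
    exact φ.map_coord_zero 0 rfl
  simp only [sub_self, sub_zero, AffineMap.lineMap_apply_one_sub] at h
  change ∫ t in (0 : ℝ)..1, ω (AffineMap.lineMap b a t) ![a - b] = -segmentCurrent a b ω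
  simp only [hneg, intervalIntegral.integral_neg, h, segmentCurrent_apply]

theorem Current.mass_add_le {m : ℕ} (S S' : Current m) : (S + S').mass ≤ S.mass + S'.mass := by
  refine iSup₂_le fun ω hω => ?_
  rw [add_apply]
  exact ENNReal.ofReal_add_le.trans (add_le_add
    (le_iSup₂ (f := fun (ω : TestForm m) (_ : ∀ x, ‖ω x‖ ≤ 1) => ENNReal.ofReal (S ω)) ω hω)
    (le_iSup₂ (f := fun (ω : TestForm m) (_ : ∀ x, ‖ω x‖ ≤ 1) => ENNReal.ofReal (S' ω)) ω hω))

theorem Current.mass_le_of_abs_le {m : ℕ} {S : Current m} {c : ℝ}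
    (h : ∀ ω : TestForm m, (∀ x, ‖ω x‖ ≤ 1) → |S ω| ≤ c) : S.mass ≤ ENNReal.ofReal c :=
  iSup₂_le fun ω hω => ENNReal.ofReal_le_ofReal ((le_abs_self _).trans (h ω hω))

theorem Current.mass_zero {m : ℕ} : (0 : Current m).mass = 0 := by
  simp [Current.mass]

theorem mass_segmentCurrent_le (a b : Plane) :
    (segmentCurrent a b).mass ≤ ENNReal.ofReal ‖b - a‖ := by
  refine Current.mass_le_of_abs_le fun ω hω => ?_
  have h := intervalIntegral.norm_integral_le_of_norm_le_const (a := (0 : ℝ)) (b := 1)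
    (C := ‖b - a‖) (f := fun t : ℝ => ω (AffineMap.lineMap a b t) ![b - a])
    (fun t _ => by
      refine ((ω (AffineMap.lineMap a b t)).le_opNorm _).trans ?_
      simpa using mul_le_mul_of_nonneg_right (hω (AffineMap.lineMap a b t)) (norm_nonneg (b - a)))
  simpa [segmentCurrent_apply] using h

theorem Current.boundary_add {m : ℕ} (S S' : Current (m + 1)) :
    (S + S').boundary = S.boundary + S'.boundary := rfl

theorem Current.IsIntegral.add {S S' : Current 2} (h : S.IsIntegral) (h' : S'.IsIntegral) :
    (S + S').IsIntegral := by
  obtain ⟨⟨θ, hi, hc, hS⟩, hb⟩ := h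
  obtain ⟨⟨θ', hi', hc', hS'⟩, hb'⟩ := h'
  have hint : ∀ {θ : Plane → ℝ}, Integrable θ → ∀ ω : TestForm 2, Integrable fun x =>
      θ x * ω x ![EuclideanSpace.single 0 1, EuclideanSpace.single 1 1] := fun h ω => by
    simpa [areaCoeff_apply, mul_comm] using
      TestFunction.integrable_bilin ((ContinuousLinearMap.mul ℝ ℝ).comp areaCoeff)
        (h.locallyIntegrable.locallyIntegrableOn _) ω
  refine ⟨⟨θ + θ', ?_, hc.add hc', fun ω => ?_⟩, ?_⟩
  · exact (hi.add hi').congr (.of_forall fun x => by simp)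
  · rw [add_apply, hS, hS', ← integral_add (hint hi ω) (hint hi' ω)]
    simp [add_mul]
  · rw [Current.boundary_add]
    exact ne_top_of_le_ne_top (ENNReal.add_ne_top.2 ⟨hb, hb'⟩) (Current.mass_add_le _ _)

theorem Current.isIntegral_zero : (0 : Current 2).IsIntegral := by
  refine ⟨⟨0, by simp, HasCompactSupport.zero, by simp⟩, ?_⟩
  have : (0 : Current 2).boundary = 0 := rfl
  rw [this, Current.mass_zero]
  exact ENNReal.zero_ne_top

/-! ### Fillings -/

/-- `T` bounds an integral `2`-current of mass at most `c`. -/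
def HasFilling (T : Current 1) (c : ℝ) : Prop :=
  ∃ S : Current 2, S.IsIntegral ∧ S.boundary = T ∧ S.mass ≤ ENNReal.ofReal c

theorem HasFilling.zero : HasFilling 0 0 :=
  ⟨0, Current.isIntegral_zero, rfl, by simp [Current.mass_zero]⟩

theorem HasFilling.mono {T : Current 1} {c c' : ℝ} (h : HasFilling T c) (hc : c ≤ c') :
    HasFilling T c' :=
  let ⟨S, h1, h2, h3⟩ := h
  ⟨S, h1, h2, h3.trans (ENNReal.ofReal_le_ofReal hc)⟩

theorem HasFilling.add {T T' : Current 1} {c c' : ℝ} (h : HasFilling T c)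
    (h' : HasFilling T' c') (hc : 0 ≤ c) (hc' : 0 ≤ c') : HasFilling (T + T') (c + c') := by
  obtain ⟨S, h1, rfl, h3⟩ := h
  obtain ⟨S', h1', rfl, h3'⟩ := h'
  refine ⟨S + S', h1.add h1', rfl, (Current.mass_add_le _ _).trans ?_⟩
  rw [ENNReal.ofReal_add hc hc']
  exact add_le_add h3 h3'

/-- With the filling as competitor, `T - ∂S` vanishes and only the weighted mass remains. -/
theorem HasFilling.flatNorm_le {T : Current 1} {c lam : ℝ} (h : HasFilling T c)
    (hlam : 0 ≤ lam) : flatNorm lam T ≤ ENNReal.ofReal (lam * c) := by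
  obtain ⟨S, h1, rfl, h3⟩ := h
  refine (iInf₂_le S h1).trans ?_
  rw [sub_self, Current.mass_zero, zero_add, ENNReal.ofReal_mul hlam]
  gcongr

/-- The boundary of an oriented triangle bounds a current of mass at most its area. -/
theorem hasFilling_triangle (a b c : Plane) :
    HasFilling (segmentCurrent a b + segmentCurrent b c + segmentCurrent c a)
      (|planeDet (b - a) (c - b)| / 2) := by
  set w := b - a with hw
  set z := c - b with hz
  obtain ⟨θ, hi, hc, hθ⟩ := exists_triangle_multiplicity a w z
  obtain ⟨S, hS⟩ := exists_multiplicityCurrent hi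
  have hS' : ∀ ω : TestForm 2, S ω = planeDet w z *
      ∫ r in (0 : ℝ)..1, ∫ t in (0 : ℝ)..1, r * areaCoeff (ω (coneMap a w z (r, t))) :=
    fun ω => (hS ω).trans (hθ _ (areaCoeff.continuous.comp ω.continuous))
  have hbd : S.boundary = segmentCurrent a b + segmentCurrent b c + segmentCurrent c a := by
    rw [segmentCurrent_swap a c]
    ext ω
    have hsm : ∀ v : Plane, ContDiff ℝ 1 fun y => ω y ![v] := fun v =>
      (ContinuousAlternatingMap.apply ℝ Plane ℝ ![v]).contDiff.comp
        (ω.contDiff.of_le (by exact_mod_cast le_top))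
    have hadd : ∀ φ : Plane [⋀^Fin 1]→L[ℝ] ℝ, φ ![w] + φ ![z] = φ ![c - a] := fun φ => by
      rw [← covector_add, hw, hz, add_comm, sub_add_sub_cancel]
    have h1 : ∀ r : ℝ, coneMap a w z (r, 0) = AffineMap.lineMap a b r := fun r => by
      simp [coneMap, AffineMap.lineMap_apply, hw, add_comm]
    have h2 : ∀ r : ℝ, coneMap a w z (r, 1) = AffineMap.lineMap a c r := fun r => by
      simp [coneMap, AffineMap.lineMap_apply, hw, hz, add_comm]
    have h3 : ∀ t : ℝ, coneMap a w z (1, t) = AffineMap.lineMap b c t := fun r => by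
      simp only [coneMap, AffineMap.lineMap_apply, hw, hz, one_smul, vsub_eq_sub, vadd_eq_add]
      abel
    -- The integrand here is `dω(w, z)`; the sides `t = 0`, `r = 1`, `t = 1` of the square are the
    -- edges `ab`, `bc`, `ac`.
    have key := integral_coneMap_green (hsm w) (hsm z) a w z
    have hform : ∀ x, extDerivTest 1 ω x ![w, z] = planeDet w z * areaCoeff (extDerivTest 1 ω x) :=
      fun x => alternating_apply_eq_planeDet_mul _ w z
    simp only [← extDerivTest_apply_pair, hform, hadd, h1, h2, h3, mul_left_comm _ (planeDet w z),
      intervalIntegral.integral_const_mul] at key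
    change S (extDerivTest 1 ω) = segmentCurrent a b ω + segmentCurrent b c ω - segmentCurrent a c ω
    simp only [hS', intervalIntegral.integral_const_mul, segmentCurrent_apply]
    rw [key, add_comm (∫ t in (0 : ℝ)..1, _)]
  refine ⟨S, ⟨⟨θ, hi, hc, hS⟩, ?_⟩, hbd, Current.mass_le_of_abs_le fun ω hω => ?_⟩
  · rw [hbd]
    refine ne_top_of_le_ne_top ?_ ((Current.mass_add_le _ _).trans (add_le_add
      ((Current.mass_add_le _ _).trans (add_le_add (mass_segmentCurrent_le _ _)
        (mass_segmentCurrent_le _ _))) (mass_segmentCurrent_le _ _)))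
    simp
  · rw [hS', abs_mul, div_eq_mul_one_div]
    gcongr
    -- Comass at most `1` bounds the inner integral by `r`, and `∫ r = 1/2` gives the half in the
    -- area.
    have := intervalIntegral.norm_integral_le_of_norm_le (μ := volume) zero_le_one
      (f := fun r => ∫ t in (0 : ℝ)..1, r * areaCoeff (ω (coneMap a w z (r, t)))) (g := fun r => r)
      (.of_forall fun r hr => by
        have := intervalIntegral.norm_integral_le_of_norm_le_const (a := (0 : ℝ)) (b := 1)
          (C := r) (f := fun t => r * areaCoeff (ω (coneMap a w z (r, t)))) (fun t _ => by
            rw [norm_mul, Real.norm_of_nonneg hr.1.le]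
            exact mul_le_of_le_one_right hr.1.le ((abs_areaCoeff_le _).trans (hω _)))
        simpa using this) intervalIntegral.intervalIntegrable_id
    simpa using this

/-- Lagrange's identity: `det² + ⟨x, y⟩² = ‖x‖² ‖y‖²`. -/
theorem abs_planeDet_le (x y : Plane) : |planeDet x y| ≤ ‖x‖ * ‖y‖ := by
  refine abs_le_of_sq_le_sq ?_ (by positivity)
  rw [mul_pow, EuclideanSpace.real_norm_sq_eq, EuclideanSpace.real_norm_sq_eq, Fin.sum_univ_two,
    Fin.sum_univ_two, planeDet]
  nlinarith [sq_nonneg (x 0 * y 0 + x 1 * y 1)]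

/-- Replacing the node `v` between `u` and `w` by a point `x` at distance at most `δ`. -/
theorem hasFilling_replace_node {u v w x : Plane} {δ : ℝ} (hx : dist x v ≤ δ) :
    HasFilling ((segmentCurrent u x + segmentCurrent x w) -
        (segmentCurrent u v + segmentCurrent v w)) (δ / 2 * (dist u v + dist v w)) := by
  have h1 := (hasFilling_triangle u x v).mono (c' := δ / 2 * dist u v) <| by
    have h : planeDet (x - u) (v - x) = planeDet (x - v) (v - u) := by
      simp [planeDet]; ring
    have := abs_planeDet_le (x - v) (v - u)
    rw [← dist_eq_norm, ← dist_eq_norm, dist_comm v u] at this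
    rw [h]
    nlinarith [mul_le_mul_of_nonneg_right hx (dist_nonneg (x := u) (y := v))]
  have h2 := (hasFilling_triangle x w v).mono (c' := δ / 2 * dist v w) <| by
    have h : planeDet (w - x) (v - w) = planeDet (x - v) (w - v) := by
      simp [planeDet]; ring
    have := abs_planeDet_le (x - v) (w - v)
    rw [← dist_eq_norm, ← dist_eq_norm, dist_comm w v] at this
    rw [h]
    nlinarith [mul_le_mul_of_nonneg_right hx (dist_nonneg (x := v) (y := w))]
  have hδ : 0 ≤ δ := dist_nonneg.trans hx
  have h := h1.add h2 (by positivity) (by positivity)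
  rw [segmentCurrent_swap u v, segmentCurrent_swap v w, segmentCurrent_swap x v] at h
  convert h using 1
  · abel
  · ring

/-! ### Moving nodes of a polygonal line -/

namespace Polyline

variable {n : ℕ}

theorem current_update_sub (T : Polyline n) (k : ℕ) (hk : k + 1 < n) (x : Plane) :
    current (Function.update T ⟨k + 1, by omega⟩ x) - T.current =
      (segmentCurrent (T ⟨k, by omega⟩) x + segmentCurrent x (T ⟨k + 2, by omega⟩)) -
        (segmentCurrent (T ⟨k, by omega⟩) (T ⟨k + 1, by omega⟩) +
          segmentCurrent (T ⟨k + 1, by omega⟩) (T ⟨k + 2, by omega⟩)) := by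
  have hne : (⟨k, by omega⟩ : Fin n) ≠ ⟨k + 1, hk⟩ := by simp
  rw [current, current, ← Finset.sum_sub_distrib,
    ← Finset.sum_subset (Finset.subset_univ {⟨k, by omega⟩, ⟨k + 1, hk⟩}), Finset.sum_pair hne]
  · simp [Fin.ext_iff]
    abel
  · intro i _ hi
    simp [Fin.ext_iff] at hi
    simp [Function.update_apply, Fin.ext_iff]
    rw [if_neg (by omega), if_neg (by omega), sub_self]

/-- The `i`-th edge length, extended by zero. -/
def edgeLen (T : Polyline n) (i : ℕ) : ℝ := if h : i < n then T.edgeLength ⟨i, h⟩ else 0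

theorem edgeLen_eq (T : Polyline n) {i : ℕ} (h : i < n) :
    T.edgeLen i = dist (T ⟨i, by omega⟩) (T ⟨i + 1, by omega⟩) := by
  rw [edgeLen, dif_pos h]
  rfl

theorem edgeLen_nonneg (T : Polyline n) (i : ℕ) : 0 ≤ T.edgeLen i := by
  unfold edgeLen edgeLength
  split_ifs <;> positivity

theorem length_eq_sum_edgeLen (T : Polyline n) : T.length = ∑ i ∈ Finset.range n, T.edgeLen i := by
  rw [length, Finset.sum_range]
  exact Finset.sum_congr rfl fun i _ => by simp [edgeLen]

theorem length_sub (T : Polyline n) (i j : ℕ) (hij : i ≤ j) (hj : j ≤ n) :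
    (T.sub i j hij hj).length = ∑ k ∈ Finset.range (j - i), T.edgeLen (i + k) := by
  rw [length, Finset.sum_range]
  refine Finset.sum_congr rfl fun k _ => ?_
  rw [edgeLen_eq T (by omega)]
  rfl

end Polyline

/-- Successively moving the nodes `1, …, k` by less than `δ` leaves the later nodes fixed and
changes the current by the boundary of a current of controlled mass. -/
theorem hasFilling_of_perturbations {n : ℕ} {δ : ℝ} (T : ℕ → Polyline n)
    (hT_step : ∀ (k : ℕ) (hk : 1 ≤ k ∧ k + 1 ≤ n),
      IsPositivePerturbation δ k hk (T (k - 1)) (T k)) (hδ : 0 ≤ δ) (k : ℕ) (hk : k < n) :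
    (∀ j : Fin (n + 1), k < j → T k j = T 0 j) ∧
      -- The case `k = 0` is the fixed start `s`; it saves one `δ` in the total.
      dist (T k ⟨k, by omega⟩) (T 0 ⟨k, by omega⟩) ≤ (if k = 0 then 0 else δ) ∧
      HasFilling ((T k).current - (T 0).current) (∑ i ∈ Finset.range k,
        δ / 2 * ((T 0).edgeLen i + (if i = 0 then 0 else δ) + (T 0).edgeLen (i + 1))) := by
  induction k with
  | zero => exact ⟨fun _ _ => rfl, by simp, by simpa using HasFilling.zero⟩
  | succ k ih =>
    obtain ⟨h1, h2, h3⟩ := ih (by omega)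
    obtain ⟨x, ⟨hx, -⟩, hT⟩ := hT_step (k + 1) ⟨by omega, by omega⟩
    have hxδ : dist x (T k ⟨k + 1, by omega⟩) ≤ δ := (Metric.mem_ball.1 hx.1).le
    simp only [Nat.add_sub_cancel] at hT
    have e1 := h1 ⟨k + 1, by omega⟩ (by simp)
    have e2 := h1 ⟨k + 2, by omega⟩ (by simp)
    refine ⟨fun j hj => ?_, ?_, ?_⟩
    · rw [hT, Function.update_of_ne (by simp [Fin.ext_iff]; omega)]
      exact h1 j (by omega)
    · rw [hT, Function.update_self, ← e1]
      simpa using hxδ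
    · have hnode := hasFilling_replace_node (u := T k ⟨k, by omega⟩) (w := T k ⟨k + 2, by omega⟩) hxδ
      rw [← Polyline.current_update_sub (T k) k hk x, ← hT, e1, e2,
        ← Polyline.edgeLen_eq (T 0) (i := k + 1) hk] at hnode
      -- The preceding node has already moved, so its edge may have grown by that displacement.
      have hd : dist (T k ⟨k, by omega⟩) (T 0 ⟨k + 1, by omega⟩) ≤
          (T 0).edgeLen k + (if k = 0 then 0 else δ) := by
        rw [Polyline.edgeLen_eq (T 0) (i := k) (by omega)]
        linarith [dist_triangle (T k ⟨k, by omega⟩) (T 0 ⟨k, by omega⟩) (T 0 ⟨k + 1, by omega⟩)]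
      have hpos : ∀ i, 0 ≤ δ / 2 *
          ((T 0).edgeLen i + (if i = 0 then 0 else δ) + (T 0).edgeLen (i + 1)) := fun i => by
        have := (T 0).edgeLen_nonneg i
        have := (T 0).edgeLen_nonneg (i + 1)
        split_ifs <;> positivity
      have := h3.add (hnode.mono (by gcongr)) (Finset.sum_nonneg fun i _ => hpos i) (hpos k)
      rw [Finset.sum_range_succ]
      convert this using 1
      abel

end

theorem mainTheorem7 (n : ℕ) (hn : 3 ≤ n) (s t : Plane) (T₀ : Polyline n) (hT₀ : IsPWL n s t T₀)
    (lam δ : ℝ) (hlam : 0 < lam) (hδ : 0 < δ)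
    (T : ℕ → Polyline n) (hT_zero : T 0 = T₀)
    (hT_step : ∀ (k : ℕ) (hk : 1 ≤ k ∧ k + 1 ≤ n),
      IsPositivePerturbation δ k hk (T (k - 1)) (T k)) :
    flatNorm lam ((T (n - 1)).current - T₀.current) ≤
        ENNReal.ofReal (lam * δ / 2 *
          (T₀.length + (T₀.sub 1 (n - 1) (by omega) (by omega)).length + ((n : ℝ) - 2) * δ)) ∧
      lam * δ / 2 *
          (T₀.length + (T₀.sub 1 (n - 1) (by omega) (by omega)).length + ((n : ℝ) - 2) * δ) =
        lam * δ *
          (T₀.length - (T₀.edgeLength ⟨0, by omega⟩ + T₀.edgeLength ⟨n - 1, by omega⟩) / 2 +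
            ((n : ℝ) - 2) * δ / 2) := by
  subst hT_zero
  have hfill := (hasFilling_of_perturbations T hT_step hδ.le (n - 1) (by omega)).2.2
  obtain ⟨m, rfl⟩ := Nat.exists_eq_add_of_le' hn
  simp only [Polyline.length_eq_sum_edgeLen (T 0), Polyline.length_sub,
    show m + 3 - 1 = m + 2 by omega, show m + 2 - 1 = m + 1 by omega] at hfill ⊢
  have hl : (T 0).edgeLength ⟨m + 2, by omega⟩ = (T 0).edgeLen (m + 2) := by
    simp [Polyline.edgeLen]
  have h0 : (T 0).edgeLength ⟨0, by omega⟩ = (T 0).edgeLen 0 := by simp [Polyline.edgeLen]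
  constructor
  · refine (hfill.flatNorm_le hlam.le).trans (ENNReal.ofReal_le_ofReal (le_of_eq ?_))
    -- Splitting off the last edge from the shifted sum completes the other sum to `|T₀|` and leaves
    -- the interior length.
    rw [← Finset.mul_sum, Finset.sum_add_distrib, Finset.sum_add_distrib,
      Finset.sum_range_succ' (fun i => if i = 0 then (0 : ℝ) else δ),
      Finset.sum_range_succ (fun i => (T 0).edgeLen i) (m + 2),
      Finset.sum_range_succ (fun i => (T 0).edgeLen (i + 1)) (m + 1)]
    simp [add_comm 1]
    ring
  · rw [hl, h0, Finset.sum_range_succ, Finset.sum_range_succ']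
    simp only [add_comm 1]
    ring
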